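/- **Setting.** Let $\mathcal H_A,\mathcal H_B$ be Hilbert spaces of finite dimensions $d_A,d_B\ge 1$. An *ensemble* of unitaries on $\mathcal H_A\otimes\mathcal H_B$ is a Borel probability measure $\nu$ on the unitary group $\mathcal U(d_Ad_B)$ (for instance the uniform distribution on a finite set of unitaries). It is a *unitary $2$-design* if $$\int P(V)\,d\nu(V)=\int_{\mathcal U(d_Ad_B)}P(V)\,d\mu(V)$$ for every complex polynomial $P$ of degree at most $2$ in the entries of $V$ and at most $2$ in the entries of $V^\dagger$, where $\mu$ is the normalized Haar measure. Let $H$ be a Hermitian operator and $\rho$ a density matrix (positive semidefinite, trace one) on $\mathcal H_A\otimes\mathcal H_B$. Let $w(H)=\lambda_{\max}(H)-\lambda_{\min}(H)$ be the spectral width of $H$. For unitaries $V_1,V_2$ on $\mathcal H_A\otimes\mathcal H_B$ and $U_A\in\mathcal U(d_A)$, put $\mathbf U=V_2(U_A\otimes I_B)V_1$ and $$\Delta_{H,\rho}(V_1,V_2)=\max_{U_A\in\mathcal U(d_A)}\operatorname{tr}(H\mathbf U\rho\mathbf U^\dagger)-\min_{U_A\in\mathcal U(d_A)}\operatorname{tr}(H\mathbf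 U\rho\mathbf U^\dagger).$$ **Theorem.** Let $V_1,V_2$ be sampled independently from ensembles $\mathbb V_1,\mathbb V_2$, at least one of which is a unitary $2$-design. Then $\Delta_{H,\rho}$ is integrable and $$\mathbb E_{V_1,V_2}[\Delta_{H,\rho}(V_1,V_2)]\le 4\,w(H)\,d_A^2\sqrt{\frac{d_A}{d_B}},$$ $$\operatorname{Var}_{V_1,V_2}[\Delta_{H,\rho}(V_1,V_2)]\le 4\,w(H)^2\,d_A^2\sqrt{\frac{d_A}{d_B}},$$ and, for every $\epsilon>0$, $$\Pr[\Delta_{H,\rho}(V_1,V_2)\ge\epsilon]\le\frac{4\,w(H)\,d_A^2}{\epsilon}\sqrt{\frac{d_A}{d_B}}.$$ In particular, for a system of $n$ qubits of which $m\le n$ belong to $A$ ($d_A=2^m$, $d_B=2^{n-m}$), $$\mathbb E[\Delta_{H,\rho}]\le\frac{w(H)}{2^{n/2-3m-2}},\qquad \operatorname{Var}[\Delta_{H,\rho}]\le\frac{w(H)^2}{2^{n/2-3m-2}},\qquad \Pr[\Delta_{H,\rho}\ge\epsilon]\le\frac1\epsilon\cdot\frac{w(H)}{2^{n/2-3m-2}}\quad(\epsilon>0).$$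 -/

import Mathlib

open MeasureTheory ProbabilityTheory
open scoped Matrix Kronecker

namespace VQA

/-! ### The unitary group as a compact topological group with its Borel structure -/

/-- The Borel `σ`-algebra on the unitary group `U(ι)`. -/
noncomputable instance instMeasurableSpaceUnitary {ι : Type*} [Fintype ι] [DecidableEq ι] :
    MeasurableSpace (Matrix.unitaryGroup ι ℂ) :=
  borel _

instance instBorelSpaceUnitary {ι : Type*} [Fintype ι] [DecidableEq ι] :
    BorelSpace (Matrix.unitaryGroup ι ℂ) :=
  ⟨rfl⟩

instance instCompactSpaceUnitary {ι : Type*} [Fintype ι] [DecidableEq ι] :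
    CompactSpace (Matrix.unitaryGroup ι ℂ) := by
  apply isCompact_iff_compactSpace.mp
  have hK : IsCompact
      (Set.univ.pi fun _ : ι => Set.univ.pi fun _ : ι => Metric.closedBall (0 : ℂ) 1) :=
    isCompact_univ_pi fun _ => isCompact_univ_pi fun _ => isCompact_closedBall _ _
  refine IsCompact.of_isClosed_subset hK
    (isClosed_unitary (R := Matrix ι ι ℂ)) fun U hU i _ j _ => ?_
  rw [mem_closedBall_zero_iff]
  exact entry_norm_bound_of_unitary hU i j

/-- The normalized Haar measure on the unitary group: total mass one. -/
noncomputable def haarUnitary (ι : Type*) [Fintype ι] [DecidableEq ι] :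
    Measure (Matrix.unitaryGroup ι ℂ) :=
  Measure.haarMeasure ⊤

/-! ### Unitary designs -/

/-- Polynomials in two families of variables, standing for the entries of `V` (left) and of `Vᴴ`
(right), of degree at most `t` in the first family and at most `t` in the second. -/
def HasBidegreeLE {ι : Type*} [Fintype ι] (t : ℕ)
    (P : MvPolynomial ((ι × ι) ⊕ (ι × ι)) ℂ) : Prop :=
  ∀ s ∈ P.support, (∑ e : ι × ι, s (Sum.inl e)) ≤ t ∧ (∑ e : ι × ι, s (Sum.inr e)) ≤ t

/-- The value of such a polynomial at the entries of `V` and of `Vᴴ`. -/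
noncomputable def evalAt {ι : Type*} (P : MvPolynomial ((ι × ι) ⊕ (ι × ι)) ℂ)
    (V : Matrix ι ι ℂ) : ℂ :=
  MvPolynomial.eval (Sum.elim (fun e => V e.1 e.2) (fun e => Vᴴ e.1 e.2)) P

/-- An ensemble of unitaries, given by its law `ν` on the unitary group (the uniform law on a finite
set of unitaries being a special case), is a unitary `t`-design if every polynomial of degree at
most `t` in the entries of `V` and at most `t` in those of `Vᴴ` has the same average over the
ensemble as over the Haar measure. -/
def IsUnitaryDesign {ι : Type*} [Fintype ι] [DecidableEq ι] (t : ℕ)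
    (ν : Measure (Matrix.unitaryGroup ι ℂ)) : Prop :=
  ∀ P : MvPolynomial ((ι × ι) ⊕ (ι × ι)) ℂ, HasBidegreeLE t P →
    ∫ V, evalAt P V.1 ∂ν = ∫ V, evalAt P V.1 ∂(haarUnitary ι)

/-! ### The cost function and its variation range -/

section Density

open scoped ComplexOrder

/-- A density matrix: positive semidefinite of trace one. -/
def IsDensityMatrix {ι : Type*} [Fintype ι] (ρ : Matrix ι ι ℂ) : Prop :=
  ρ.PosSemidef ∧ ρ.trace = 1

end Density

/-- The spectral width `λ_max(H) - λ_min(H)` of a Hermitian matrix. -/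
noncomputable def spectralWidth {ι : Type*} [Fintype ι] [DecidableEq ι] (H : Matrix ι ι ℂ) : ℝ :=
  sSup (spectrum ℝ H) - sInf (spectrum ℝ H)

/-- The circuit `V₂ (U_A ⊗ I_B) V₁`. -/
noncomputable def circuit {A B : Type*} [Fintype A] [DecidableEq A] [Fintype B] [DecidableEq B]
    (V₁ V₂ : Matrix.unitaryGroup (A × B) ℂ) (UA : Matrix.unitaryGroup A ℂ) :
    Matrix (A × B) (A × B) ℂ :=
  V₂.1 * (UA.1 ⊗ₖ (1 : Matrix B B ℂ)) * V₁.1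

/-- The cost function `tr (H U ρ U†)`; this trace is real for Hermitian `H` and `ρ`. -/
noncomputable def cost {ι : Type*} [Fintype ι] (H ρ U : Matrix ι ι ℂ) : ℝ :=
  (H * U * ρ * Uᴴ).trace.re

/-- The variation range: maximum minus minimum of the cost over all unitaries `U_A` (both are
attained, see `exists_isMaxOn_cost` and `exists_isMinOn_cost`). -/
noncomputable def variationRange {A B : Type*} [Fintype A] [DecidableEq A] [Fintype B]
    [DecidableEq B] (H ρ : Matrix (A × B) (A × B) ℂ)
    (V : Matrix.unitaryGroup (A × B) ℂ × Matrix.unitaryGroup (A × B) ℂ) : ℝ :=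
  (⨆ UA : Matrix.unitaryGroup A ℂ, cost H ρ (circuit V.1 V.2 UA)) -
    ⨅ UA : Matrix.unitaryGroup A ℂ, cost H ρ (circuit V.1 V.2 UA)

theorem continuous_cost_circuit {A B : Type*} [Fintype A] [DecidableEq A] [Fintype B]
    [DecidableEq B] (H ρ : Matrix (A × B) (A × B) ℂ) (V₁ V₂ : Matrix.unitaryGroup (A × B) ℂ) :
    Continuous fun UA : Matrix.unitaryGroup A ℂ => cost H ρ (circuit V₁ V₂ UA) := by
  have hk : Continuous fun UA : Matrix.unitaryGroup A ℂ => UA.1 ⊗ₖ (1 : Matrix B B ℂ) := by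
    refine continuous_matrix fun i j => ?_
    simp only [Matrix.kroneckerMap_apply]
    exact (continuous_subtype_val.matrix_elem i.1 j.1).mul continuous_const
  have hc : Continuous fun UA : Matrix.unitaryGroup A ℂ => circuit V₁ V₂ UA :=
    (continuous_const.matrix_mul hk).matrix_mul continuous_const
  exact Complex.continuous_re.comp
    ((((continuous_const.matrix_mul hc).matrix_mul continuous_const).matrix_mul
      hc.matrix_conjTranspose).matrix_trace)

theorem exists_isMaxOn_cost {A B : Type*} [Fintype A] [DecidableEq A] [Fintype B]
    [DecidableEq B] (H ρ : Matrix (A × B) (A × B) ℂ) (V₁ V₂ : Matrix.unitaryGroup (A × B) ℂ) :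
    ∃ U₀ : Matrix.unitaryGroup A ℂ,
      (∀ UA, cost H ρ (circuit V₁ V₂ UA) ≤ cost H ρ (circuit V₁ V₂ U₀)) ∧
      cost H ρ (circuit V₁ V₂ U₀) = ⨆ UA, cost H ρ (circuit V₁ V₂ UA) := by
  obtain ⟨U₀, -, h⟩ := isCompact_univ.exists_isMaxOn Set.univ_nonempty
    (continuous_cost_circuit H ρ V₁ V₂).continuousOn
  have h' : ∀ UA, cost H ρ (circuit V₁ V₂ UA) ≤ cost H ρ (circuit V₁ V₂ U₀) :=
    fun UA => h (Set.mem_univ UA)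
  exact ⟨U₀, h', le_antisymm (le_ciSup ⟨_, Set.forall_mem_range.2 h'⟩ U₀) (ciSup_le h')⟩

theorem exists_isMinOn_cost {A B : Type*} [Fintype A] [DecidableEq A] [Fintype B]
    [DecidableEq B] (H ρ : Matrix (A × B) (A × B) ℂ) (V₁ V₂ : Matrix.unitaryGroup (A × B) ℂ) :
    ∃ U₀ : Matrix.unitaryGroup A ℂ,
      (∀ UA, cost H ρ (circuit V₁ V₂ U₀) ≤ cost H ρ (circuit V₁ V₂ UA)) ∧
      cost H ρ (circuit V₁ V₂ U₀) = ⨅ UA, cost H ρ (circuit V₁ V₂ UA) := by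
  obtain ⟨U₀, -, h⟩ := isCompact_univ.exists_isMinOn Set.univ_nonempty
    (continuous_cost_circuit H ρ V₁ V₂).continuousOn
  have h' : ∀ UA, cost H ρ (circuit V₁ V₂ U₀) ≤ cost H ρ (circuit V₁ V₂ UA) :=
    fun UA => h (Set.mem_univ UA)
  exact ⟨U₀, h', le_antisymm (le_ciInf h') (ciInf_le ⟨_, Set.forall_mem_range.2 h'⟩ U₀)⟩

end VQA

/-!
A bilinear form on matrices invariant under simultaneous unitary conjugation is a combination
`α tr (X Y) + β tr X tr Y`. This determines the second moments of `V K Vᴴ` for Haar-random `V`, and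
a 2-design has the same ones, since they are integrals of polynomials of bidegree `(2, 2)`.

The cost of a local unitary `U` is the value at `(U, Uᴴ)` of the bilinear form
`(M, N) ↦ tr (P (M ⊗ 1) Q (N ⊗ 1))`, where `P` and `Q` are the conjugates of `H` by `V₂` and of `ρ`
by `V₁`. The Hilbert-Schmidt norm of this form controls all local unitaries at once, and the mean
of its square is a sum of second moments. Subtracting scalars from `H` and `ρ` leaves `Δ`
unchanged, so both may be taken traceless, and the second moments are then small. This bounds
`𝔼 Δ²`; with `0 ≤ Δ ≤ w(H)`, the bounds on the mean, the variance and the tail follow.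
-/

namespace VQA

instance instSecondCountableUnitary {ι : Type*} [Fintype ι] [DecidableEq ι] :
    SecondCountableTopology (Matrix.unitaryGroup ι ℂ) :=
  haveI : SecondCountableTopology (Matrix ι ι ℂ) :=
    inferInstanceAs (SecondCountableTopology (ι → ι → ℂ))
  TopologicalSpace.Subtype.secondCountableTopology (Matrix.unitaryGroup ι ℂ : Set (Matrix ι ι ℂ))

instance instIsHaarMeasureHaarUnitary {ι : Type*} [Fintype ι] [DecidableEq ι] :
    (haarUnitary ι).IsHaarMeasure := by
  unfold haarUnitary; infer_instance

instance instIsProbabilityMeasureHaarUnitary {ι : Type*} [Fintype ι] [DecidableEq ι] :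
    IsProbabilityMeasure (haarUnitary ι) :=
  ⟨by simpa [haarUnitary] using
    Measure.haarMeasure_self (K₀ := (⊤ : TopologicalSpace.PositiveCompacts
      (Matrix.unitaryGroup ι ℂ)))⟩

theorem integrable_of_continuous {X E : Type*} [TopologicalSpace X] [CompactSpace X]
    [MeasurableSpace X] [OpensMeasurableSpace X] [NormedAddCommGroup E] {μ : Measure X}
    [IsFiniteMeasure μ] {f : X → E} (hf : Continuous f) : Integrable f μ :=
  hf.integrable_of_hasCompactSupport (HasCompactSupport.of_compactSpace f)

section TraceForm

variable {ι : Type*} [Fintype ι]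

/-- The bilinear form `(X, Y) ↦ tr (X Y)`, which with `traceProdForm` spans the unitarily invariant
forms. -/
noncomputable def traceMulForm (ι : Type*) [Fintype ι] : LinearMap.BilinForm ℂ (Matrix ι ι ℂ) :=
  (LinearMap.mul ℂ (Matrix ι ι ℂ)).compr₂ (Matrix.traceLinearMap ι ℂ ℂ)

/-- The bilinear form `(X, Y) ↦ tr X * tr Y`, which with `traceMulForm` spans the unitarily
invariant forms. -/
noncomputable def traceProdForm (ι : Type*) [Fintype ι] : LinearMap.BilinForm ℂ (Matrix ι ι ℂ) :=
  (LinearMap.mul ℂ ℂ).compl₁₂ (Matrix.traceLinearMap ι ℂ ℂ) (Matrix.traceLinearMap ι ℂ ℂ)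

@[simp]
theorem traceMulForm_apply (X Y : Matrix ι ι ℂ) : traceMulForm ι X Y = (X * Y).trace := rfl

@[simp]
theorem traceProdForm_apply (X Y : Matrix ι ι ℂ) : traceProdForm ι X Y = X.trace * Y.trace := rfl

end TraceForm

section Unitary

variable {ι : Type*} [Fintype ι] [DecidableEq ι]

theorem conjTranspose_mul_self_of_unitary (V : Matrix.unitaryGroup ι ℂ) : V.1ᴴ * V.1 = 1 :=
  Matrix.mem_unitaryGroup_iff'.1 V.2

theorem mul_conjTranspose_self_of_unitary (V : Matrix.unitaryGroup ι ℂ) : V.1 * V.1ᴴ = 1 :=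
  Matrix.mem_unitaryGroup_iff.1 V.2

theorem trace_unitary_conj (V : Matrix.unitaryGroup ι ℂ) (K : Matrix ι ι ℂ) :
    (V.1 * K * V.1ᴴ).trace = K.trace := by
  rw [Matrix.trace_mul_comm, ← mul_assoc, conjTranspose_mul_self_of_unitary, one_mul]

theorem unitary_conj_mul_unitary_conj (V : Matrix.unitaryGroup ι ℂ) (K L : Matrix ι ι ℂ) :
    V.1 * K * V.1ᴴ * (V.1 * L * V.1ᴴ) = V.1 * (K * L) * V.1ᴴ := by
  simp only [mul_assoc]
  rw [← mul_assoc V.1ᴴ V.1, conjTranspose_mul_self_of_unitary, one_mul]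

theorem eq_unitary_conj_diagonal {H : Matrix ι ι ℂ} (hH : H.IsHermitian) :
    H = hH.eigenvectorUnitary.1 * Matrix.diagonal (fun i => (hH.eigenvalues i : ℂ)) *
      hH.eigenvectorUnitary.1ᴴ := by
  conv_lhs => rw [hH.spectral_theorem, Unitary.conjStarAlgAut_apply]
  rfl

/-- A bilinear form on square matrices is unitarily invariant if simultaneous conjugation of both
arguments by a unitary does not change it; the second moments of a Haar-random conjugate
`V K Vᴴ` are of this kind. -/
def IsUnitarilyInvariant (β : LinearMap.BilinForm ℂ (Matrix ι ι ℂ)) : Prop :=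
  ∀ W : Matrix.unitaryGroup ι ℂ, ∀ X Y, β (W.1 * X * W.1ᴴ) (W.1 * Y * W.1ᴴ) = β X Y

theorem isUnitarilyInvariant_traceMulForm : IsUnitarilyInvariant (traceMulForm ι) :=
  fun W X Y => by
    simp only [traceMulForm_apply, unitary_conj_mul_unitary_conj, trace_unitary_conj]

theorem isUnitarilyInvariant_traceProdForm : IsUnitarilyInvariant (traceProdForm ι) :=
  fun W X Y => by simp only [traceProdForm_apply, trace_unitary_conj]

namespace IsUnitarilyInvariant

variable {β γ : LinearMap.BilinForm ℂ (Matrix ι ι ℂ)}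

theorem sub (hβ : IsUnitarilyInvariant β) (hγ : IsUnitarilyInvariant γ) :
    IsUnitarilyInvariant (β - γ) :=
  fun W X Y => by simp only [LinearMap.sub_apply, hβ W, hγ W]

theorem smul (hβ : IsUnitarilyInvariant β) (c : ℂ) : IsUnitarilyInvariant (c • β) :=
  fun W X Y => by simp only [LinearMap.smul_apply, hβ W]

-- Conjugation by the diagonal unitary with entry `-1` at `k` and `1` elsewhere fixes the matrix
-- unit `E i i` and negates `E k l`.
theorem apply_single_single_of_ne (hβ : IsUnitarilyInvariant β) (i : ι) {k l : ι} (hkl : k ≠ l) :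
    β (Matrix.single i i 1) (Matrix.single k l 1) = 0 := by
  set D : Matrix ι ι ℂ := Matrix.diagonal fun a => if a = k then -1 else 1 with hD
  have hDstar : Dᴴ = D := by
    rw [hD, Matrix.diagonal_conjTranspose]
    congr 1
    ext a
    by_cases h : a = k <;> simp [h]
  have hDD : D * D = 1 := by
    rw [hD, Matrix.diagonal_mul_diagonal, ← Matrix.diagonal_one]
    congr 1
    ext a
    by_cases h : a = k <;> simp [h]
  have hDmem : D ∈ Matrix.unitaryGroup ι ℂ :=
    Matrix.mem_unitaryGroup_iff.2 ((congrArg (D * ·) hDstar).trans hDD)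
  have hconj : ∀ a b, D * Matrix.single a b 1 * Dᴴ = (D a a * D b b) • Matrix.single a b 1 := by
    intro a b
    rw [hDstar, hD]
    ext p q
    simp only [Matrix.diagonal_mul, Matrix.mul_diagonal, Matrix.diagonal_apply_eq,
      Matrix.smul_apply, Matrix.single_apply, smul_eq_mul]
    grind
  have hDi : D i i * D i i = 1 := by
    by_cases h : i = k <;> simp [hD, h]
  have hDkl : D k k * D l l = -1 := by simp [hD, hkl.symm]
  have h := hβ ⟨D, hDmem⟩ (Matrix.single i i 1) (Matrix.single k l 1)
  rw [hconj, hconj, hDi, hDkl, one_smul, neg_one_smul, map_neg] at h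
  exact neg_eq_self.1 h

theorem eq_zero_of_apply_single_single (hβ : IsUnitarilyInvariant β)
    (h : ∀ i k, β (Matrix.single i i 1) (Matrix.single k k 1) = 0) : β = 0 := by
  have hsingle : ∀ i, β (Matrix.single i i 1) = 0 := fun i => by
    refine Matrix.ext_linearMap ℂ fun k l => LinearMap.ext_ring ?_
    rcases eq_or_ne k l with rfl | hkl
    · exact h i k
    · exact hβ.apply_single_single_of_ne i hkl
  have hdiagonal : ∀ D : ι → ℂ, β (Matrix.diagonal D) = 0 := fun D => by
    rw [← Matrix.sum_single_eq_diagonal, map_sum]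
    refine Finset.sum_eq_zero fun i _ => ?_
    rw [← mul_one (D i), ← smul_eq_mul, ← Matrix.smul_single, map_smul, hsingle, smul_zero]
  have hhermitian : ∀ X : Matrix ι ι ℂ, X.IsHermitian → β X = 0 := fun X hX => by
    ext1 Y
    have hY : Y = hX.eigenvectorUnitary.1 *
        (hX.eigenvectorUnitary.1ᴴ * Y * hX.eigenvectorUnitary.1) *
          hX.eigenvectorUnitary.1ᴴ := by
      simp only [mul_assoc, mul_conjTranspose_self_of_unitary, mul_one]
      rw [← mul_assoc, mul_conjTranspose_self_of_unitary, one_mul]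
    rw [eq_unitary_conj_diagonal hX, hY, hβ, hdiagonal, LinearMap.zero_apply,
      LinearMap.zero_apply]
  exact LinearMap.ext_on (span_selfAdjoint (A := Matrix ι ι ℂ)) fun X hX => hhermitian X hX

theorem apply_single_single_perm (hβ : IsUnitarilyInvariant β) (σ : Equiv.Perm ι) (i k : ι) :
    β (Matrix.single (σ i) (σ i) 1) (Matrix.single (σ k) (σ k) 1) =
      β (Matrix.single i i 1) (Matrix.single k k 1) := by
  set S : Matrix ι ι ℂ := σ⁻¹.permMatrix ℂ with hS
  have hSstar : Sᴴ = σ.permMatrix ℂ := by rw [hS, Matrix.conjTranspose_permMatrix, inv_inv]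
  have hSmem : S ∈ Matrix.unitaryGroup ι ℂ := by
    rw [Matrix.mem_unitaryGroup_iff, Matrix.star_eq_conjTranspose, hSstar, hS,
      ← Matrix.permMatrix_mul, mul_inv_cancel, Matrix.permMatrix_one]
  have hconj : ∀ a, S * Matrix.single a a 1 * Sᴴ = Matrix.single (σ a) (σ a) 1 := fun a => by
    rw [hSstar, hS, Equiv.Perm.permMatrix, Equiv.Perm.permMatrix, PEquiv.toMatrix_toPEquiv_mul,
      PEquiv.mul_toMatrix_toPEquiv]
    ext p q
    simp [Matrix.single_apply, Equiv.eq_symm_apply]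
  have h := hβ ⟨S, hSmem⟩ (Matrix.single i i 1) (Matrix.single k k 1)
  rwa [hconj, hconj] at h

theorem exists_apply_single_single_eq (hβ : IsUnitarilyInvariant β) :
    ∃ a b : ℂ, ∀ i k, β (Matrix.single i i 1) (Matrix.single k k 1) =
      a * (if i = k then 1 else 0) + b := by
  rcases subsingleton_or_nontrivial ι with _ | _
  · rcases isEmpty_or_nonempty ι with _ | ⟨⟨p⟩⟩
    · exact ⟨0, 0, fun i => isEmptyElim i⟩
    · refine ⟨0, β (Matrix.single p p 1) (Matrix.single p p 1), fun i k => ?_⟩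
      rw [Subsingleton.elim i p, Subsingleton.elim k p, zero_mul, zero_add]
  · obtain ⟨p, q, hpq⟩ := exists_pair_ne ι
    refine ⟨β (Matrix.single p p 1) (Matrix.single p p 1) -
      β (Matrix.single p p 1) (Matrix.single q q 1),
      β (Matrix.single p p 1) (Matrix.single q q 1), fun i k => ?_⟩
    rcases eq_or_ne i k with rfl | hik
    · have h := hβ.apply_single_single_perm (Equiv.swap p i) p p
      rw [Equiv.swap_apply_left] at h
      simp [h]
    · obtain ⟨σ, rfl, rfl⟩ := MulAction.is_two_pretransitive_iff.1
        (Equiv.Perm.isMultiplyPretransitive ι 2) hpq hik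
      simpa [hpq] using hβ.apply_single_single_perm σ p q

theorem exists_eq_add (hβ : IsUnitarilyInvariant β) :
    ∃ a b : ℂ, ∀ X Y, β X Y = a * (X * Y).trace + b * (X.trace * Y.trace) := by
  obtain ⟨a, b, hab⟩ := hβ.exists_apply_single_single_eq
  have hzero : β - a • traceMulForm ι - b • traceProdForm ι = 0 := by
    refine ((hβ.sub (isUnitarilyInvariant_traceMulForm.smul a)).sub
      (isUnitarilyInvariant_traceProdForm.smul b)).eq_zero_of_apply_single_single fun i k => ?_
    simp only [LinearMap.sub_apply, LinearMap.smul_apply, hab, traceMulForm_apply,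
      traceProdForm_apply, Matrix.trace_single_mul, Matrix.trace_single_eq_same, smul_eq_mul,
      Matrix.single_apply]
    grind
  refine ⟨a, b, fun X Y => ?_⟩
  have h := congrArg (fun γ : LinearMap.BilinForm ℂ (Matrix ι ι ℂ) => γ X Y) hzero
  simp only [LinearMap.sub_apply, LinearMap.smul_apply, traceMulForm_apply, traceProdForm_apply,
    smul_eq_mul, LinearMap.zero_apply] at h
  linear_combination h

end IsUnitarilyInvariant

theorem sum_trace_single_mul_trace_single (M N : Matrix ι ι ℂ) :
    ∑ i, ∑ j, (Matrix.single i j 1 * M).trace * (Matrix.single j i 1 * N).trace =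
      (M * N).trace := by
  simp only [Matrix.trace_single_mul, one_smul]
  rw [Finset.sum_comm]
  simp only [Matrix.trace, Matrix.diag_apply, Matrix.mul_apply]

section Moment

variable {ν : Measure (Matrix.unitaryGroup ι ℂ)} [IsFiniteMeasure ν]

theorem integrable_trace_mul_trace (X Y K L : Matrix ι ι ℂ) :
    Integrable (fun V : Matrix.unitaryGroup ι ℂ =>
      (X * (V.1 * K * V.1ᴴ)).trace * (Y * (V.1 * L * V.1ᴴ)).trace) ν :=
  integrable_of_continuous (by fun_prop)

variable (ν) in
/-- The mixed second moment `(X, Y) ↦ 𝔼 [tr (X V K Vᴴ) * tr (Y V L Vᴴ)]` of the conjugates of `K`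
and `L` by a random unitary `V` with law `ν`. -/
noncomputable def conjMoment (K L : Matrix ι ι ℂ) : LinearMap.BilinForm ℂ (Matrix ι ι ℂ) :=
  LinearMap.mk₂ ℂ
    (fun X Y => ∫ V, (X * (V.1 * K * V.1ᴴ)).trace * (Y * (V.1 * L * V.1ᴴ)).trace ∂ν)
    (fun X X' Y => by
      simp only [add_mul, Matrix.trace_add]
      exact integral_add (integrable_trace_mul_trace X Y K L) (integrable_trace_mul_trace X' Y K L))
    (fun c X Y => by
      simp only [smul_mul_assoc, Matrix.trace_smul]
      exact integral_smul c _)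
    (fun X Y Y' => by
      simp only [add_mul, mul_add, Matrix.trace_add]
      exact integral_add (integrable_trace_mul_trace X Y K L) (integrable_trace_mul_trace X Y' K L))
    (fun c X Y => by
      simp only [smul_mul_assoc, Matrix.trace_smul, mul_smul_comm]
      exact integral_smul c _)

theorem conjMoment_apply (K L X Y : Matrix ι ι ℂ) :
    conjMoment ν K L X Y =
      ∫ V, (X * (V.1 * K * V.1ᴴ)).trace * (Y * (V.1 * L * V.1ᴴ)).trace ∂ν :=
  rfl

theorem conjMoment_one_one [IsProbabilityMeasure ν] (K L : Matrix ι ι ℂ) :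
    conjMoment ν K L 1 1 = K.trace * L.trace := by
  simp [conjMoment_apply, trace_unitary_conj]

theorem sum_conjMoment_single_single [IsProbabilityMeasure ν] (K L : Matrix ι ι ℂ) :
    ∑ i, ∑ j, conjMoment ν K L (Matrix.single i j 1) (Matrix.single j i 1) = (K * L).trace := by
  have hconst : ∀ V : Matrix.unitaryGroup ι ℂ,
      ∑ i, ∑ j, (Matrix.single i j 1 * (V.1 * K * V.1ᴴ)).trace *
        (Matrix.single j i 1 * (V.1 * L * V.1ᴴ)).trace = (K * L).trace := fun V => by
    rw [sum_trace_single_mul_trace_single, unitary_conj_mul_unitary_conj, trace_unitary_conj]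
  calc ∑ i, ∑ j, conjMoment ν K L (Matrix.single i j 1) (Matrix.single j i 1)
      = ∫ V, ∑ i, ∑ j, (Matrix.single i j 1 * (V.1 * K * V.1ᴴ)).trace *
          (Matrix.single j i 1 * (V.1 * L * V.1ᴴ)).trace ∂ν := by
        simp only [conjMoment_apply]
        rw [integral_finsetSum _ fun i _ => integrable_finsetSum _ fun j _ =>
          integrable_trace_mul_trace _ _ _ _]
        refine Finset.sum_congr rfl fun i _ => ?_
        rw [integral_finsetSum _ fun j _ => integrable_trace_mul_trace _ _ _ _]
    _ = (K * L).trace := by simp only [hconst, integral_const, probReal_univ, one_smul]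

end Moment

theorem isUnitarilyInvariant_conjMoment_haarUnitary (K L : Matrix ι ι ℂ) :
    IsUnitarilyInvariant (conjMoment (haarUnitary ι) K L) := by
  intro W X Y
  have htrace : ∀ (V : Matrix.unitaryGroup ι ℂ) (Z M : Matrix ι ι ℂ),
      (W.1 * Z * W.1ᴴ * (V.1 * M * V.1ᴴ)).trace =
        (Z * ((W⁻¹ * V).1 * M * (W⁻¹ * V).1ᴴ)).trace := fun V Z M => by
    have hW : (W⁻¹ * V).1 = W.1ᴴ * V.1 := rfl
    rw [hW, Matrix.conjTranspose_mul, Matrix.conjTranspose_conjTranspose, mul_assoc, mul_assoc,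
      Matrix.trace_mul_comm]
    simp only [mul_assoc]
  simp only [conjMoment_apply, htrace]
  exact integral_mul_left_eq_self (fun V : Matrix.unitaryGroup ι ℂ =>
    (X * (V.1 * K * V.1ᴴ)).trace * (Y * (V.1 * L * V.1ᴴ)).trace) W⁻¹

-- The two coefficients of the invariant form `conjMoment` are determined by its value at `(1, 1)`
-- and by the sum of its values at the pairs `(E i j, E j i)`.
theorem card_mul_conjMoment_haarUnitary (K L X Y : Matrix ι ι ℂ) :
    (Fintype.card ι * ((Fintype.card ι : ℂ) ^ 2 - 1)) * conjMoment (haarUnitary ι) K L X Y =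
      (X * Y).trace * (Fintype.card ι * (K * L).trace - K.trace * L.trace) +
        X.trace * Y.trace * (Fintype.card ι * (K.trace * L.trace) - (K * L).trace) := by
  obtain ⟨a, b, hab⟩ :=
    (isUnitarilyInvariant_conjMoment_haarUnitary K L).exists_eq_add
  have hone := conjMoment_one_one (ν := haarUnitary ι) K L
  rw [hab, mul_one, Matrix.trace_one] at hone
  have hsum := sum_conjMoment_single_single (ν := haarUnitary ι) K L
  have hcard := sum_trace_single_mul_trace_single (1 : Matrix ι ι ℂ) 1
  have hcard_sq : ∑ i : ι, ∑ j : ι,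
      (Matrix.single i j (1 : ℂ) * Matrix.single j i 1).trace = (Fintype.card ι : ℂ) ^ 2 := by
    simp [sq]
  simp only [mul_one, Matrix.trace_one] at hcard
  simp only [hab, Finset.sum_add_distrib, ← Finset.mul_sum, hcard, hcard_sq] at hsum
  rw [hab]
  linear_combination ((X * Y).trace * Fintype.card ι - X.trace * Y.trace) * hsum
    - ((X * Y).trace - X.trace * Y.trace * Fintype.card ι) * hone

end Unitary

section Design

variable {ι : Type*} [Fintype ι]

namespace HasBidegreeLE

variable {s t : ℕ} {P Q : MvPolynomial ((ι × ι) ⊕ (ι × ι)) ℂ}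

theorem mul (hP : HasBidegreeLE s P) (hQ : HasBidegreeLE t Q) : HasBidegreeLE (s + t) (P * Q) := by
  classical
  intro u hu
  obtain ⟨p, hp, q, hq, rfl⟩ := Finset.mem_add.1 (MvPolynomial.support_mul P Q hu)
  simp only [Finsupp.add_apply, Finset.sum_add_distrib]
  exact ⟨add_le_add (hP p hp).1 (hQ q hq).1, add_le_add (hP p hp).2 (hQ q hq).2⟩

theorem sum {α : Type*} {S : Finset α} {F : α → MvPolynomial ((ι × ι) ⊕ (ι × ι)) ℂ}
    (hF : ∀ a ∈ S, HasBidegreeLE t (F a)) : HasBidegreeLE t (∑ a ∈ S, F a) := by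
  classical
  intro u hu
  obtain ⟨a, ha, hua⟩ := Finset.mem_biUnion.1 (MvPolynomial.support_sum hu)
  exact hF a ha u hua

theorem monomial_inl_add_inr (e f : ι × ι) (c : ℂ) :
    HasBidegreeLE 1 (MvPolynomial.monomial
      (Finsupp.single (Sum.inl e) 1 + Finsupp.single (Sum.inr f) 1) c) := by
  classical
  intro u hu
  rw [Finset.mem_singleton.1 (MvPolynomial.support_monomial_subset hu)]
  simp [Finsupp.single_apply]

end HasBidegreeLE

/-- The polynomial `tr (X V K Vᴴ)` in the entries of `V` and `Vᴴ`, whose products of two are the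
test polynomials on which a 2-design is compared with Haar measure. -/
noncomputable def traceConjPoly (X K : Matrix ι ι ℂ) : MvPolynomial ((ι × ι) ⊕ (ι × ι)) ℂ :=
  ∑ i, ∑ j, ∑ k, ∑ l, MvPolynomial.monomial
    (Finsupp.single (Sum.inl (j, k)) 1 + Finsupp.single (Sum.inr (l, i)) 1) (X i j * K k l)

theorem hasBidegreeLE_traceConjPoly (X K : Matrix ι ι ℂ) : HasBidegreeLE 1 (traceConjPoly X K) :=
  .sum fun _ _ => .sum fun _ _ => .sum fun _ _ => .sum fun _ _ => .monomial_inl_add_inr _ _ _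

theorem evalAt_traceConjPoly (X K V : Matrix ι ι ℂ) :
    evalAt (traceConjPoly X K) V = (X * (V * K * Vᴴ)).trace := by
  simp only [evalAt, traceConjPoly, map_sum, MvPolynomial.eval_monomial, Matrix.trace,
    Matrix.diag_apply, Matrix.mul_apply, Finset.mul_sum, Finset.sum_mul]
  refine Finset.sum_congr rfl fun i _ => Finset.sum_congr rfl fun j _ => ?_
  rw [Finset.sum_comm]
  refine Finset.sum_congr rfl fun l _ => Finset.sum_congr rfl fun k _ => ?_
  rw [Finsupp.prod_add_index' (by simp) (by simp [pow_add])]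
  simp only [pow_zero, Finsupp.prod_single_index, Sum.elim_inl, Sum.elim_inr, pow_one]
  ring

theorem IsUnitaryDesign.integral_trace_mul_trace [DecidableEq ι]
    {ν : Measure (Matrix.unitaryGroup ι ℂ)} (hν : IsUnitaryDesign 2 ν) (X Y K L : Matrix ι ι ℂ) :
    ∫ V, (X * (V.1 * K * V.1ᴴ)).trace * (Y * (V.1 * L * V.1ᴴ)).trace ∂ν =
      conjMoment (haarUnitary ι) K L X Y := by
  have heval : ∀ V : Matrix ι ι ℂ, evalAt (traceConjPoly X K * traceConjPoly Y L) V =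
      (X * (V * K * Vᴴ)).trace * (Y * (V * L * Vᴴ)).trace := fun V => by
    rw [← evalAt_traceConjPoly, ← evalAt_traceConjPoly, evalAt, map_mul]
    rfl
  simpa only [heval, conjMoment_apply] using
    hν _ ((hasBidegreeLE_traceConjPoly X K).mul (hasBidegreeLE_traceConjPoly Y L))

end Design

section HilbertSchmidt

variable {m n : Type*} [Fintype m] [Fintype n]

/-- The squared Hilbert-Schmidt norm. It is a plain function and not the norm of
`Matrix.frobeniusNormedAddCommGroup`, so that the topology of the matrix space has one source. -/
noncomputable def hsNormSq (M : Matrix m n ℂ) : ℝ :=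
  ∑ i, ∑ j, ‖M i j‖ ^ 2

theorem hsNormSq_nonneg (M : Matrix m n ℂ) : 0 ≤ hsNormSq M := by
  unfold hsNormSq; positivity

theorem hsNormSq_eq_trace (M : Matrix m n ℂ) : (hsNormSq M : ℂ) = (M * Mᴴ).trace := by
  simp [hsNormSq, Matrix.trace, Matrix.mul_apply, Complex.mul_conj, Complex.normSq_eq_norm_sq]

theorem hsNormSq_conjTranspose (M : Matrix m n ℂ) : hsNormSq Mᴴ = hsNormSq M := by
  simp only [hsNormSq, Matrix.conjTranspose_apply, norm_star]
  exact Finset.sum_comm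

theorem hsNormSq_unitary [DecidableEq n] (U : Matrix.unitaryGroup n ℂ) :
    hsNormSq U.1 = Fintype.card n := by
  have h := hsNormSq_eq_trace U.1
  rw [mul_conjTranspose_self_of_unitary, Matrix.trace_one] at h
  exact_mod_cast h

theorem hsNormSq_unitary_conj [DecidableEq n] (V : Matrix.unitaryGroup n ℂ) (K : Matrix n n ℂ) :
    hsNormSq (V.1 * K * V.1ᴴ) = hsNormSq K := by
  have hstar : (V.1 * K * V.1ᴴ)ᴴ = V.1 * Kᴴ * V.1ᴴ := by
    simp only [Matrix.conjTranspose_mul, Matrix.conjTranspose_conjTranspose, mul_assoc]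
  have h : (hsNormSq (V.1 * K * V.1ᴴ) : ℂ) = hsNormSq K := by
    rw [hsNormSq_eq_trace, hsNormSq_eq_trace, hstar, unitary_conj_mul_unitary_conj,
      trace_unitary_conj]
  exact_mod_cast h

theorem norm_sq_apply_le_hsNormSq_mul [DecidableEq m] [DecidableEq n] {E : Type*}
    [SeminormedAddCommGroup E] [NormedSpace ℂ E] (f : Matrix m n ℂ →ₗ[ℂ] E) (M : Matrix m n ℂ) :
    ‖f M‖ ^ 2 ≤ hsNormSq M * ∑ p : m × n, ‖f (Matrix.single p.1 p.2 1)‖ ^ 2 := by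
  have hM : f M = ∑ p : m × n, M p.1 p.2 • f (Matrix.single p.1 p.2 1) := by
    conv_lhs => rw [Matrix.matrix_eq_sum_single M]
    simp only [map_sum, Fintype.sum_prod_type, ← map_smul, Matrix.smul_single, smul_eq_mul, mul_one]
  calc ‖f M‖ ^ 2
      ≤ (∑ p : m × n, ‖M p.1 p.2‖ * ‖f (Matrix.single p.1 p.2 1)‖) ^ 2 := by
        rw [hM]
        gcongr
        exact (norm_sum_le _ _).trans_eq (by simp only [norm_smul])
    _ ≤ (∑ p : m × n, ‖M p.1 p.2‖ ^ 2) * ∑ p : m × n, ‖f (Matrix.single p.1 p.2 1)‖ ^ 2 :=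
        Finset.sum_mul_sq_le_sq_mul_sq _ _ _
    _ = hsNormSq M * ∑ p : m × n, ‖f (Matrix.single p.1 p.2 1)‖ ^ 2 := by
        rw [hsNormSq, Fintype.sum_prod_type]

theorem norm_sq_apply_apply_le_hsNormSq_mul [DecidableEq n]
    (β : LinearMap.BilinForm ℂ (Matrix n n ℂ)) (M N : Matrix n n ℂ) :
    ‖β M N‖ ^ 2 ≤ hsNormSq M * hsNormSq N * ∑ p : n × n, ∑ q : n × n,
      ‖β (Matrix.single p.1 p.2 1) (Matrix.single q.1 q.2 1)‖ ^ 2 := by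
  calc ‖β M N‖ ^ 2
      ≤ hsNormSq M * ∑ p : n × n, ‖β (Matrix.single p.1 p.2 1) N‖ ^ 2 :=
        norm_sq_apply_le_hsNormSq_mul (LinearMap.flip β N) M
    _ ≤ hsNormSq M * ∑ p : n × n, hsNormSq N * ∑ q : n × n,
          ‖β (Matrix.single p.1 p.2 1) (Matrix.single q.1 q.2 1)‖ ^ 2 := by
        gcongr with p _
        · exact hsNormSq_nonneg M
        · exact norm_sq_apply_le_hsNormSq_mul (β (Matrix.single p.1 p.2 1)) N
    _ = _ := by rw [← Finset.mul_sum, mul_assoc]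

theorem IsUnitaryDesign.card_mul_integral_norm_sq_trace [DecidableEq n]
    {ν : Measure (Matrix.unitaryGroup n ℂ)} (hν : IsUnitaryDesign 2 ν) (X K : Matrix n n ℂ) :
    Fintype.card n * ((Fintype.card n : ℝ) ^ 2 - 1) *
        ∫ V, ‖(X * (V.1 * K * V.1ᴴ)).trace‖ ^ 2 ∂ν =
      hsNormSq X * (Fintype.card n * hsNormSq K - ‖K.trace‖ ^ 2) +
        ‖X.trace‖ ^ 2 * (Fintype.card n * ‖K.trace‖ ^ 2 - hsNormSq K) := by
  have hstar : ∀ V : Matrix.unitaryGroup n ℂ,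
      (Xᴴ * (V.1 * Kᴴ * V.1ᴴ)).trace = star (X * (V.1 * K * V.1ᴴ)).trace := fun V => by
    rw [← Matrix.trace_conjTranspose, Matrix.conjTranspose_mul, Matrix.trace_mul_comm]
    simp only [Matrix.conjTranspose_mul, Matrix.conjTranspose_conjTranspose, mul_assoc]
  have hmoment : conjMoment (haarUnitary n) K Kᴴ X Xᴴ =
      ((∫ V, ‖(X * (V.1 * K * V.1ᴴ)).trace‖ ^ 2 ∂ν : ℝ) : ℂ) := by
    rw [← hν.integral_trace_mul_trace, ← integral_complex_ofReal]
    refine integral_congr_ae (.of_forall fun V => ?_)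
    simp only [hstar, Complex.star_def, Complex.mul_conj, Complex.normSq_eq_norm_sq]
  have h := card_mul_conjMoment_haarUnitary K Kᴴ X Xᴴ
  rw [hmoment, ← hsNormSq_eq_trace, ← hsNormSq_eq_trace, Matrix.trace_conjTranspose,
    Matrix.trace_conjTranspose, Complex.star_def, Complex.mul_conj, Complex.mul_conj,
    Complex.normSq_eq_norm_sq, Complex.normSq_eq_norm_sq] at h
  exact_mod_cast h

theorem IsUnitaryDesign.integral_norm_sq_trace_le [DecidableEq n]
    {ν : Measure (Matrix.unitaryGroup n ℂ)} (hν : IsUnitaryDesign 2 ν) {X K : Matrix n n ℂ}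
    (h : X.trace = 0 ∨ K.trace = 0) :
    ((Fintype.card n : ℝ) ^ 2 - 1) * ∫ V, ‖(X * (V.1 * K * V.1ᴴ)).trace‖ ^ 2 ∂ν ≤
      hsNormSq X * hsNormSq K := by
  have heq := hν.card_mul_integral_norm_sq_trace X K
  have hI : 0 ≤ ∫ V, ‖(X * (V.1 * K * V.1ᴴ)).trace‖ ^ 2 ∂ν := integral_nonneg fun V => by positivity
  have hX := hsNormSq_nonneg X
  have hK := hsNormSq_nonneg K
  rcases (Nat.cast_nonneg (α := ℝ) (Fintype.card n)).eq_or_lt with hd | hd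
  · rw [← hd]
    nlinarith [mul_nonneg hX hK]
  · refine le_of_mul_le_mul_left ?_ hd
    rcases h with h | h <;> rw [h, norm_zero] at heq
    · nlinarith [mul_nonneg hX (sq_nonneg ‖K.trace‖)]
    · nlinarith [mul_nonneg hK (sq_nonneg ‖X.trace‖)]

theorem IsUnitaryDesign.integral_sum_norm_sq_trace_le [DecidableEq n]
    {ν : Measure (Matrix.unitaryGroup n ℂ)} [IsFiniteMeasure ν] (hν : IsUnitaryDesign 2 ν)
    {α : Type*} [Fintype α] {X K : α → Matrix n n ℂ}
    (h : ∀ a, (X a).trace = 0 ∨ (K a).trace = 0) :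
    ((Fintype.card n : ℝ) ^ 2 - 1) * ∫ V, ∑ a, ‖(X a * (V.1 * K a * V.1ᴴ)).trace‖ ^ 2 ∂ν ≤
      ∑ a, hsNormSq (X a) * hsNormSq (K a) := by
  rw [integral_finsetSum _ fun a _ => integrable_of_continuous (by fun_prop), Finset.mul_sum]
  exact Finset.sum_le_sum fun a _ => hν.integral_norm_sq_trace_le (h a)

end HilbertSchmidt

section LocalForm

variable {A B : Type*} [Fintype A] [DecidableEq A] [Fintype B] [DecidableEq B]

theorem sum_hsNormSq_kronecker_one_mul {n : Type*} [Fintype n] (P : Matrix (A × B) n ℂ) :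
    ∑ p : A × A, hsNormSq ((Matrix.single p.1 p.2 1 ⊗ₖ (1 : Matrix B B ℂ)) * P) =
      Fintype.card A * hsNormSq P := by
  have hentry : ∀ (k l a : A) (b : B) (j : n),
      ((Matrix.single k l (1 : ℂ) ⊗ₖ (1 : Matrix B B ℂ)) * P : Matrix (A × B) n ℂ) (a, b) j =
        if k = a then P (l, b) j else 0 := fun k l a b j => by
    simp [Matrix.mul_apply, Fintype.sum_prod_type, Matrix.kroneckerMap_apply, Matrix.single_apply,
      Matrix.one_apply, ite_and]
  have hblock : ∀ k l : A, hsNormSq ((Matrix.single k l 1 ⊗ₖ (1 : Matrix B B ℂ)) * P) =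
      ∑ b, ∑ j, ‖P (l, b) j‖ ^ 2 := fun k l => by
    simp only [hsNormSq, Fintype.sum_prod_type, hentry]
    rw [Finset.sum_eq_single k (fun a _ ha => by simp [ha.symm]) (by simp)]
    simp only [if_true]
  simp only [Fintype.sum_prod_type, hblock, Finset.sum_const, Finset.card_univ, nsmul_eq_mul]
  simp only [hsNormSq, Fintype.sum_prod_type]

theorem sum_hsNormSq_mul_kronecker_one {n : Type*} [Fintype n] (P : Matrix n (A × B) ℂ) :
    ∑ p : A × A, hsNormSq (P * (Matrix.single p.1 p.2 1 ⊗ₖ (1 : Matrix B B ℂ))) =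
      Fintype.card A * hsNormSq P := by
  rw [← hsNormSq_conjTranspose P, ← sum_hsNormSq_kronecker_one_mul]
  refine Fintype.sum_equiv (Equiv.prodComm A A) _ _ fun p => ?_
  rw [← hsNormSq_conjTranspose, Matrix.conjTranspose_mul, Matrix.conjTranspose_kronecker,
    Matrix.conjTranspose_single, star_one, Matrix.conjTranspose_one]
  rfl

theorem sum_hsNormSq_kronecker_one_mul_mul_kronecker_one (P : Matrix (A × B) (A × B) ℂ) :
    ∑ p : A × A, ∑ q : A × A, hsNormSq ((Matrix.single p.1 p.2 1 ⊗ₖ (1 : Matrix B B ℂ)) * P *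
        (Matrix.single q.1 q.2 1 ⊗ₖ (1 : Matrix B B ℂ))) =
      (Fintype.card A : ℝ) ^ 2 * hsNormSq P := by
  simp only [sum_hsNormSq_mul_kronecker_one, ← Finset.mul_sum, sum_hsNormSq_kronecker_one_mul]
  ring

/-- The bilinear form `(M, N) ↦ tr (P (M ⊗ 1) Q (N ⊗ 1))` on local operators. At `M = U` and
`N = Uᴴ` it is the cost of the local unitary `U`. -/
noncomputable def localForm (P Q : Matrix (A × B) (A × B) ℂ) :
    LinearMap.BilinForm ℂ (Matrix A A ℂ) :=
  LinearMap.mk₂ ℂ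
    (fun M N => (P * (M ⊗ₖ (1 : Matrix B B ℂ)) * Q * (N ⊗ₖ (1 : Matrix B B ℂ))).trace)
    (fun M M' N => by simp only [Matrix.add_kronecker, mul_add, add_mul, Matrix.trace_add])
    (fun c M N => by
      simp only [Matrix.smul_kronecker, mul_smul_comm, smul_mul_assoc, Matrix.trace_smul])
    (fun M N N' => by simp only [Matrix.add_kronecker, mul_add, Matrix.trace_add])
    (fun c M N => by simp only [Matrix.smul_kronecker, mul_smul_comm, Matrix.trace_smul])

theorem localForm_apply (P Q : Matrix (A × B) (A × B) ℂ) (M N : Matrix A A ℂ) :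
    localForm P Q M N =
      (P * (M ⊗ₖ (1 : Matrix B B ℂ)) * Q * (N ⊗ₖ (1 : Matrix B B ℂ))).trace :=
  rfl

/-- The squared Hilbert-Schmidt norm of `localForm P Q`. It bounds the form at all local unitaries
simultaneously, which replaces the maximum over local unitaries by a second moment. -/
noncomputable def localFormNormSq (P Q : Matrix (A × B) (A × B) ℂ) : ℝ :=
  ∑ p : A × A, ∑ q : A × A,
    ‖localForm P Q (Matrix.single p.1 p.2 1) (Matrix.single q.1 q.2 1)‖ ^ 2

theorem norm_sq_localForm_unitary_le (P Q : Matrix (A × B) (A × B) ℂ)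
    (U : Matrix.unitaryGroup A ℂ) :
    ‖localForm P Q U.1 U.1ᴴ‖ ^ 2 ≤ (Fintype.card A : ℝ) ^ 2 * localFormNormSq P Q := by
  refine (norm_sq_apply_apply_le_hsNormSq_mul (localForm P Q) U.1 U.1ᴴ).trans_eq ?_
  rw [hsNormSq_conjTranspose, hsNormSq_unitary, ← sq, localFormNormSq]

@[fun_prop]
theorem continuous_localFormNormSq {X : Type*} [TopologicalSpace X]
    {P Q : X → Matrix (A × B) (A × B) ℂ} (hP : Continuous P) (hQ : Continuous Q) :
    Continuous fun x => localFormNormSq (P x) (Q x) := by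
  simp only [localFormNormSq, localForm_apply]
  fun_prop

variable {ν : Measure (Matrix.unitaryGroup (A × B) ℂ)} [IsFiniteMeasure ν]

theorem IsUnitaryDesign.integral_localFormNormSq_conj_right_le (hν : IsUnitaryDesign 2 ν)
    (P : Matrix (A × B) (A × B) ℂ) {K : Matrix (A × B) (A × B) ℂ} (hK : K.trace = 0) :
    ((Fintype.card (A × B) : ℝ) ^ 2 - 1) * ∫ V, localFormNormSq P (V.1 * K * V.1ᴴ) ∂ν ≤
      (Fintype.card A : ℝ) ^ 2 * (hsNormSq P * hsNormSq K) := by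
  have hcyc : ∀ (V : Matrix.unitaryGroup (A × B) ℂ) (M N : Matrix A A ℂ),
      localForm P (V.1 * K * V.1ᴴ) M N = ((N ⊗ₖ (1 : Matrix B B ℂ)) * P *
        (M ⊗ₖ (1 : Matrix B B ℂ)) * (V.1 * K * V.1ᴴ)).trace := fun V M N => by
    rw [localForm_apply, Matrix.trace_mul_comm]
    simp only [mul_assoc]
  simp only [localFormNormSq, hcyc, ← Fintype.sum_prod_type']
  refine (hν.integral_sum_norm_sq_trace_le fun _ => .inr hK).trans_eq ?_
  rw [← Finset.sum_mul, Fintype.sum_prod_type_right,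
    sum_hsNormSq_kronecker_one_mul_mul_kronecker_one, mul_assoc]

theorem IsUnitaryDesign.integral_localFormNormSq_conj_left_le (hν : IsUnitaryDesign 2 ν)
    {K : Matrix (A × B) (A × B) ℂ} (hK : K.trace = 0) (Q : Matrix (A × B) (A × B) ℂ) :
    ((Fintype.card (A × B) : ℝ) ^ 2 - 1) * ∫ V, localFormNormSq (V.1ᴴ * K * V.1) Q ∂ν ≤
      (Fintype.card A : ℝ) ^ 2 * (hsNormSq K * hsNormSq Q) := by
  have hcyc : ∀ (V : Matrix.unitaryGroup (A × B) ℂ) (M N : Matrix A A ℂ),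
      localForm (V.1ᴴ * K * V.1) Q M N = (K * (V.1 * ((M ⊗ₖ (1 : Matrix B B ℂ)) * Q *
        (N ⊗ₖ (1 : Matrix B B ℂ))) * V.1ᴴ)).trace := fun V M N => by
    simp only [localForm_apply, mul_assoc]
    rw [Matrix.trace_mul_comm]
    simp only [mul_assoc]
  simp only [localFormNormSq, hcyc, ← Fintype.sum_prod_type']
  refine (hν.integral_sum_norm_sq_trace_le fun _ => .inl hK).trans_eq ?_
  rw [← Finset.mul_sum, Fintype.sum_prod_type,
    sum_hsNormSq_kronecker_one_mul_mul_kronecker_one, mul_left_comm]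

end LocalForm

section Spectral

variable {n : Type*} [Fintype n] [DecidableEq n]

theorem hsNormSq_sub_smul_one_of_trace_eq_zero {K : Matrix n n ℂ} (hK : K.trace = 0) (z : ℂ) :
    hsNormSq (K - z • (1 : Matrix n n ℂ)) = hsNormSq K + ‖z‖ ^ 2 * Fintype.card n := by
  have h : (hsNormSq (K - z • (1 : Matrix n n ℂ)) : ℂ) =
      ((hsNormSq K + ‖z‖ ^ 2 * Fintype.card n : ℝ) : ℂ) := by
    push_cast
    rw [hsNormSq_eq_trace, hsNormSq_eq_trace, ← Complex.ofReal_pow, ← Complex.normSq_eq_norm_sq,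
      ← Complex.mul_conj]
    simp [sub_mul, mul_sub, hK, Matrix.trace_conjTranspose]
    ring
  exact_mod_cast h

/-- The traceless part `M - (tr M / n) 1` of a matrix, its Hilbert-Schmidt projection onto the
matrices of trace zero. -/
noncomputable def tracelessPart (M : Matrix n n ℂ) : Matrix n n ℂ :=
  M - (M.trace / Fintype.card n) • (1 : Matrix n n ℂ)

theorem trace_tracelessPart (M : Matrix n n ℂ) : (tracelessPart M).trace = 0 := by
  cases isEmpty_or_nonempty n
  · simp [Matrix.trace]
  · simp [tracelessPart]

theorem hsNormSq_tracelessPart_le (M : Matrix n n ℂ) (z : ℂ) :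
    hsNormSq (tracelessPart M) ≤ hsNormSq (M - z • (1 : Matrix n n ℂ)) := by
  have hM : M - z • (1 : Matrix n n ℂ) =
      tracelessPart M - (z - M.trace / Fintype.card n) • (1 : Matrix n n ℂ) := by
    rw [tracelessPart]
    module
  rw [hM, hsNormSq_sub_smul_one_of_trace_eq_zero (trace_tracelessPart M)]
  exact le_add_of_nonneg_right (by positivity)

theorem hsNormSq_diagonal (D : n → ℂ) : hsNormSq (Matrix.diagonal D) = ∑ i, ‖D i‖ ^ 2 := by
  simp [hsNormSq, Matrix.diagonal_apply, apply_ite norm, ite_pow]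

theorem hsNormSq_sub_smul_one_eq_sum_eigenvalues {H : Matrix n n ℂ} (hH : H.IsHermitian) (c : ℝ) :
    hsNormSq (H - (c : ℂ) • (1 : Matrix n n ℂ)) = ∑ i, (hH.eigenvalues i - c) ^ 2 := by
  have hdiag : Matrix.diagonal (fun i => ((hH.eigenvalues i - c : ℝ) : ℂ)) =
      Matrix.diagonal (fun i => (hH.eigenvalues i : ℂ)) - (c : ℂ) • (1 : Matrix n n ℂ) := by
    ext i j
    by_cases hij : i = j <;> simp [hij]
  have hconj : H - (c : ℂ) • (1 : Matrix n n ℂ) = hH.eigenvectorUnitary.1 *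
      Matrix.diagonal (fun i => ((hH.eigenvalues i - c : ℝ) : ℂ)) *
        hH.eigenvectorUnitary.1ᴴ := by
    rw [hdiag, mul_sub, sub_mul, ← eq_unitary_conj_diagonal hH, mul_smul_comm, smul_mul_assoc,
      mul_one, mul_conjTranspose_self_of_unitary]
  rw [hconj, hsNormSq_unitary_conj, hsNormSq_diagonal]
  simp only [Complex.norm_real, Real.norm_eq_abs, sq_abs]

theorem spectralWidth_nonneg (H : Matrix n n ℂ) : 0 ≤ spectralWidth H :=
  sub_nonneg.2 <| Real.sInf_le_sSup _ H.finite_real_spectrum.bddBelow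
    H.finite_real_spectrum.bddAbove

theorem eigenvalues_mem_Icc_spectrum {H : Matrix n n ℂ} (hH : H.IsHermitian) (i : n) :
    hH.eigenvalues i ∈ Set.Icc (sInf (spectrum ℝ H)) (sSup (spectrum ℝ H)) := by
  rw [hH.spectrum_real_eq_range_eigenvalues]
  exact ⟨csInf_le (Set.finite_range _).bddBelow (Set.mem_range_self i),
    le_csSup (Set.finite_range _).bddAbove (Set.mem_range_self i)⟩

theorem exists_hsNormSq_sub_smul_one_le {H : Matrix n n ℂ} (hH : H.IsHermitian) :
    ∃ c : ℂ, hsNormSq (H - c • (1 : Matrix n n ℂ)) ≤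
      Fintype.card n * (spectralWidth H ^ 2 / 4) := by
  refine ⟨((sInf (spectrum ℝ H) + sSup (spectrum ℝ H)) / 2 : ℝ), ?_⟩
  rw [hsNormSq_sub_smul_one_eq_sum_eigenvalues hH, ← nsmul_eq_mul, ← Finset.card_univ]
  refine Finset.sum_le_card_nsmul _ _ _ fun i _ => ?_
  obtain ⟨hinf, hsup⟩ := eigenvalues_mem_Icc_spectrum hH i
  unfold spectralWidth
  nlinarith

end Spectral

section DensityMatrix

open scoped ComplexOrder

variable {n : Type*} [Fintype n]

theorem IsDensityMatrix.nonempty {ρ : Matrix n n ℂ} (hρ : IsDensityMatrix ρ) : Nonempty n := by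
  by_contra hempty
  rw [not_nonempty_iff] at hempty
  simpa [Matrix.trace] using hρ.2

theorem IsDensityMatrix.hsNormSq_le_one {ρ : Matrix n n ℂ} (hρ : IsDensityMatrix ρ) :
    hsNormSq ρ ≤ 1 := by
  classical
  have hherm := hρ.1.isHermitian
  have hsum : ∑ i, hherm.eigenvalues i = 1 := by
    simpa using congrArg Complex.re (hherm.trace_eq_sum_eigenvalues.symm.trans hρ.2)
  calc hsNormSq ρ = ∑ i, hherm.eigenvalues i ^ 2 := by
        simpa using hsNormSq_sub_smul_one_eq_sum_eigenvalues hherm 0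
    _ ≤ (∑ i, hherm.eigenvalues i) ^ 2 :=
        Finset.sum_sq_le_sq_sum_of_nonneg fun i _ => hρ.1.eigenvalues_nonneg i
    _ = 1 := by rw [hsum, one_pow]

variable [DecidableEq n]

theorem IsDensityMatrix.unitary_conj {ρ : Matrix n n ℂ} (hρ : IsDensityMatrix ρ)
    (V : Matrix.unitaryGroup n ℂ) : IsDensityMatrix (V.1 * ρ * V.1ᴴ) :=
  ⟨hρ.1.mul_mul_conjTranspose_same _, by rw [trace_unitary_conj, hρ.2]⟩

theorem IsDensityMatrix.trace_mul_mem_Icc {H ρ : Matrix n n ℂ} (hρ : IsDensityMatrix ρ)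
    (hH : H.IsHermitian) :
    (H * ρ).trace.re ∈ Set.Icc (sInf (spectrum ℝ H)) (sSup (spectrum ℝ H)) := by
  set W := hH.eigenvectorUnitary
  set σ := W.1ᴴ * ρ * W.1 with hσ_def
  have hσ : IsDensityMatrix σ := by
    simpa [hσ_def, Matrix.star_eq_conjTranspose] using hρ.unitary_conj W⁻¹
  have hnonneg : ∀ i, 0 ≤ (σ i i).re := fun i => (Complex.le_def.1 hσ.1.diag_nonneg).1
  have hsum : ∑ i, (σ i i).re = 1 := by
    simpa [Matrix.trace] using congrArg Complex.re hσ.2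
  have htrace : (H * ρ).trace = (Matrix.diagonal (fun i => (hH.eigenvalues i : ℂ)) * σ).trace := by
    conv_lhs => rw [eq_unitary_conj_diagonal hH]
    rw [hσ_def, mul_assoc, mul_assoc, Matrix.trace_mul_comm, mul_assoc]
  have hcenter : (H * ρ).trace.re = ∑ i, (σ i i).re • hH.eigenvalues i := by
    rw [htrace, Matrix.trace, Complex.re_sum]
    simp [mul_comm]
  rw [hcenter]
  exact (convex_Icc _ _).sum_mem (fun i _ => hnonneg i) hsum
    fun i _ => eigenvalues_mem_Icc_spectrum hH i

end DensityMatrix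

theorem continuous_iSup_of_compactSpace {X Y : Type*} [TopologicalSpace X] [TopologicalSpace Y]
    [CompactSpace Y] {F : X → Y → ℝ} (hF : Continuous fun p : X × Y => F p.1 p.2) :
    Continuous fun x => ⨆ y, F x y := by
  simpa only [Set.image_univ, sSup_range] using isCompact_univ.continuous_sSup (f := F) hF

theorem continuous_iInf_of_compactSpace {X Y : Type*} [TopologicalSpace X] [TopologicalSpace Y]
    [CompactSpace Y] {F : X → Y → ℝ} (hF : Continuous fun p : X × Y => F p.1 p.2) :
    Continuous fun x => ⨅ y, F x y := by
  simpa only [Set.image_univ, sInf_range] using isCompact_univ.continuous_sInf (f := F) hF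

section Product

variable {X Y : Type*} [MeasurableSpace X] [MeasurableSpace Y] {μ : Measure X} {ν : Measure Y}
  {f : X × Y → ℝ} {c C : ℝ}

theorem mul_integral_prod_le_of_forall_right [SFinite μ] [IsProbabilityMeasure ν]
    (hf : Integrable f (μ.prod ν)) (h : ∀ y, c * ∫ x, f (x, y) ∂μ ≤ C) :
    c * ∫ p, f p ∂(μ.prod ν) ≤ C := by
  rw [integral_prod_symm _ hf, ← integral_const_mul]
  refine (integral_mono (hf.integral_prod_right.const_mul c) (integrable_const C) h).trans_eq ?_
  simp only [integral_const, probReal_univ, one_smul]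

theorem mul_integral_prod_le_of_forall_left [IsProbabilityMeasure μ] [SFinite ν]
    (hf : Integrable f (μ.prod ν)) (h : ∀ x, c * ∫ y, f (x, y) ∂ν ≤ C) :
    c * ∫ p, f p ∂(μ.prod ν) ≤ C := by
  rw [integral_prod _ hf, ← integral_const_mul]
  refine (integral_mono (hf.integral_prod_left.const_mul c) (integrable_const C) h).trans_eq ?_
  simp only [integral_const, probReal_univ, one_smul]

end Product

theorem sq_integral_le_integral_sq {Ω : Type*} [MeasurableSpace Ω] {μ : Measure Ω}
    [IsProbabilityMeasure μ] {X : Ω → ℝ} (hX : MemLp X 2 μ) :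
    (∫ ω, X ω ∂μ) ^ 2 ≤ ∫ ω, X ω ^ 2 ∂μ :=
  sub_nonneg.1 ((variance_nonneg X μ).trans_eq (variance_eq_sub hX))

section VariationRange

variable {A B : Type*} [Fintype A] [DecidableEq A] [Fintype B] [DecidableEq B]

theorem cost_sub_smul_one {n : Type*} [Fintype n] [DecidableEq n] (H ρ : Matrix n n ℂ) (h r : ℂ)
    (V : Matrix.unitaryGroup n ℂ) :
    cost (H - h • 1) (ρ - r • 1) V.1 =
      cost H ρ V.1 - (h * ρ.trace + r * H.trace - h * r * Fintype.card n).re := by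
  have hconj : V.1 * (ρ - r • (1 : Matrix n n ℂ)) * V.1ᴴ = V.1 * ρ * V.1ᴴ - r • 1 := by
    rw [mul_sub, sub_mul, mul_smul_comm, smul_mul_assoc, mul_one,
      mul_conjTranspose_self_of_unitary]
  have htrace : ((H - h • (1 : Matrix n n ℂ)) * (V.1 * (ρ - r • (1 : Matrix n n ℂ)) * V.1ᴴ)).trace =
      (H * (V.1 * ρ * V.1ᴴ)).trace -
        (h * ρ.trace + r * H.trace - h * r * Fintype.card n) := by
    rw [hconj]
    simp only [sub_mul, mul_sub, smul_mul_assoc, mul_smul_comm, one_mul, mul_one, Matrix.trace_sub,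
      Matrix.trace_smul, trace_unitary_conj, Matrix.trace_one, smul_eq_mul]
    ring
  simp only [cost, mul_assoc] at htrace ⊢
  rw [htrace, Complex.sub_re]

theorem circuit_mem_unitaryGroup (V₁ V₂ : Matrix.unitaryGroup (A × B) ℂ)
    (UA : Matrix.unitaryGroup A ℂ) : circuit V₁ V₂ UA ∈ Matrix.unitaryGroup (A × B) ℂ :=
  mul_mem (mul_mem V₂.2 (Matrix.kronecker_mem_unitary UA.2 (one_mem _))) V₁.2

theorem bddAbove_range_cost_circuit (H ρ : Matrix (A × B) (A × B) ℂ)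
    (V₁ V₂ : Matrix.unitaryGroup (A × B) ℂ) :
    BddAbove (Set.range fun UA => cost H ρ (circuit V₁ V₂ UA)) :=
  (isCompact_range (continuous_cost_circuit H ρ V₁ V₂)).bddAbove

theorem bddBelow_range_cost_circuit (H ρ : Matrix (A × B) (A × B) ℂ)
    (V₁ V₂ : Matrix.unitaryGroup (A × B) ℂ) :
    BddBelow (Set.range fun UA => cost H ρ (circuit V₁ V₂ UA)) :=
  (isCompact_range (continuous_cost_circuit H ρ V₁ V₂)).bddBelow

theorem variationRange_sub_smul_one (H ρ : Matrix (A × B) (A × B) ℂ) (h r : ℂ)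
    (V : Matrix.unitaryGroup (A × B) ℂ × Matrix.unitaryGroup (A × B) ℂ) :
    variationRange (H - h • 1) (ρ - r • 1) V = variationRange H ρ V := by
  have hcost : ∀ UA, cost (H - h • 1) (ρ - r • 1) (circuit V.1 V.2 UA) =
      cost H ρ (circuit V.1 V.2 UA) -
        (h * ρ.trace + r * H.trace - h * r * Fintype.card (A × B)).re := fun UA =>
    cost_sub_smul_one H ρ h r ⟨_, circuit_mem_unitaryGroup V.1 V.2 UA⟩
  simp only [variationRange, hcost]
  rw [← ciSup_sub (bddAbove_range_cost_circuit H ρ V.1 V.2),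
    ← ciInf_sub (bddBelow_range_cost_circuit H ρ V.1 V.2), sub_sub_sub_cancel_right]

theorem variationRange_tracelessPart (H ρ : Matrix (A × B) (A × B) ℂ)
    (V : Matrix.unitaryGroup (A × B) ℂ × Matrix.unitaryGroup (A × B) ℂ) :
    variationRange (tracelessPart H) (tracelessPart ρ) V = variationRange H ρ V :=
  variationRange_sub_smul_one H ρ _ _ V

theorem cost_circuit_eq_re_localForm (H ρ : Matrix (A × B) (A × B) ℂ)
    (V₁ V₂ : Matrix.unitaryGroup (A × B) ℂ) (UA : Matrix.unitaryGroup A ℂ) :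
    cost H ρ (circuit V₁ V₂ UA) =
      (localForm (V₂.1ᴴ * H * V₂.1) (V₁.1 * ρ * V₁.1ᴴ) UA.1 UA.1ᴴ).re := by
  have hadj : UA.1ᴴ ⊗ₖ (1 : Matrix B B ℂ) = (UA.1 ⊗ₖ (1 : Matrix B B ℂ))ᴴ := by
    rw [Matrix.conjTranspose_kronecker, Matrix.conjTranspose_one]
  rw [cost, localForm_apply, hadj, Matrix.mul_assoc V₂.1ᴴ, Matrix.mul_assoc V₂.1ᴴ,
    Matrix.mul_assoc V₂.1ᴴ, Matrix.mul_assoc V₂.1ᴴ, Matrix.trace_mul_comm V₂.1ᴴ]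
  simp only [circuit, Matrix.conjTranspose_mul, mul_assoc]

theorem variationRange_nonneg (H ρ : Matrix (A × B) (A × B) ℂ)
    (V : Matrix.unitaryGroup (A × B) ℂ × Matrix.unitaryGroup (A × B) ℂ) :
    0 ≤ variationRange H ρ V :=
  sub_nonneg.2 <| ciInf_le_ciSup (bddBelow_range_cost_circuit H ρ V.1 V.2)
    (bddAbove_range_cost_circuit H ρ V.1 V.2)

theorem variationRange_le_of_forall_mem_Icc {H ρ : Matrix (A × B) (A × B) ℂ}
    {V : Matrix.unitaryGroup (A × B) ℂ × Matrix.unitaryGroup (A × B) ℂ} {a b : ℝ}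
    (h : ∀ UA, cost H ρ (circuit V.1 V.2 UA) ∈ Set.Icc a b) : variationRange H ρ V ≤ b - a :=
  sub_le_sub (ciSup_le fun UA => (h UA).2) (le_ciInf fun UA => (h UA).1)

theorem variationRange_le_spectralWidth {H ρ : Matrix (A × B) (A × B) ℂ} (hH : H.IsHermitian)
    (hρ : IsDensityMatrix ρ)
    (V : Matrix.unitaryGroup (A × B) ℂ × Matrix.unitaryGroup (A × B) ℂ) :
    variationRange H ρ V ≤ spectralWidth H := by
  refine variationRange_le_of_forall_mem_Icc fun UA => ?_
  have h := (hρ.unitary_conj ⟨_, circuit_mem_unitaryGroup V.1 V.2 UA⟩).trace_mul_mem_Icc hH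
  simpa only [cost, mul_assoc] using h

theorem variationRange_sq_le_localFormNormSq (H ρ : Matrix (A × B) (A × B) ℂ)
    (V : Matrix.unitaryGroup (A × B) ℂ × Matrix.unitaryGroup (A × B) ℂ) :
    variationRange H ρ V ^ 2 ≤ 4 * (Fintype.card A : ℝ) ^ 2 *
      localFormNormSq (V.2.1ᴴ * H * V.2.1) (V.1.1 * ρ * V.1.1ᴴ) := by
  set L := (Fintype.card A : ℝ) ^ 2 *
    localFormNormSq (V.2.1ᴴ * H * V.2.1) (V.1.1 * ρ * V.1.1ᴴ) with hL_def
  have hL : ∀ UA, cost H ρ (circuit V.1 V.2 UA) ^ 2 ≤ L := fun UA => by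
    rw [cost_circuit_eq_re_localForm, ← sq_abs]
    exact (pow_le_pow_left₀ (abs_nonneg _) (Complex.abs_re_le_norm _) 2).trans
      (norm_sq_localForm_unitary_le _ _ UA)
  have hrange : variationRange H ρ V ≤ √L - -√L :=
    variationRange_le_of_forall_mem_Icc fun UA => abs_le.1 (Real.abs_le_sqrt (hL UA))
  calc variationRange H ρ V ^ 2 ≤ (√L - -√L) ^ 2 :=
        pow_le_pow_left₀ (variationRange_nonneg H ρ V) hrange 2
    _ = 4 * √L ^ 2 := by ring
    _ = 4 * (Fintype.card A : ℝ) ^ 2 *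
          localFormNormSq (V.2.1ᴴ * H * V.2.1) (V.1.1 * ρ * V.1.1ᴴ) := by
        rw [Real.sq_sqrt ((sq_nonneg _).trans (hL 1)), hL_def, mul_assoc 4]

@[fun_prop]
theorem continuous_variationRange (H ρ : Matrix (A × B) (A × B) ℂ) :
    Continuous (variationRange H ρ) := by
  have hcost : Continuous fun p : (Matrix.unitaryGroup (A × B) ℂ × Matrix.unitaryGroup (A × B) ℂ) ×
      Matrix.unitaryGroup A ℂ => cost H ρ (circuit p.1.1 p.1.2 p.2) := by
    simp only [cost_circuit_eq_re_localForm, localForm_apply]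
    have hkronecker : Continuous fun M : Matrix A A ℂ => M ⊗ₖ (1 : Matrix B B ℂ) :=
      continuous_matrix fun i j => (continuous_id.matrix_elem _ _).mul continuous_const
    fun_prop
  exact (continuous_iSup_of_compactSpace hcost).sub (continuous_iInf_of_compactSpace hcost)

end VariationRange

section Moments

variable {A B : Type*} [Fintype A] [DecidableEq A] [Fintype B] [DecidableEq B]
  {ν₁ ν₂ : Measure (Matrix.unitaryGroup (A × B) ℂ)} [IsProbabilityMeasure ν₁]
  [IsProbabilityMeasure ν₂]

theorem integrable_localFormNormSq (K L : Matrix (A × B) (A × B) ℂ) :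
    Integrable (fun V => localFormNormSq (V.2.1ᴴ * K * V.2.1) (V.1.1 * L * V.1.1ᴴ))
      (ν₁.prod ν₂) :=
  integrable_of_continuous (by fun_prop)

theorem integral_localFormNormSq_le (hν : IsUnitaryDesign 2 ν₁ ∨ IsUnitaryDesign 2 ν₂)
    {K L : Matrix (A × B) (A × B) ℂ} (hK : K.trace = 0) (hL : L.trace = 0) :
    ((Fintype.card (A × B) : ℝ) ^ 2 - 1) *
        ∫ V, localFormNormSq (V.2.1ᴴ * K * V.2.1) (V.1.1 * L * V.1.1ᴴ) ∂(ν₁.prod ν₂) ≤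
      (Fintype.card A : ℝ) ^ 2 * (hsNormSq K * hsNormSq L) := by
  rcases hν with hν | hν
  · refine mul_integral_prod_le_of_forall_right (integrable_localFormNormSq K L) fun V₂ => ?_
    have hK_conj : hsNormSq (V₂.1ᴴ * K * V₂.1) = hsNormSq K := by
      simpa [Matrix.star_eq_conjTranspose] using hsNormSq_unitary_conj V₂⁻¹ K
    have h := hν.integral_localFormNormSq_conj_right_le (V₂.1ᴴ * K * V₂.1) hL
    rwa [hK_conj] at h
  · refine mul_integral_prod_le_of_forall_left (integrable_localFormNormSq K L) fun V₁ => ?_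
    have h := hν.integral_localFormNormSq_conj_left_le hK (V₁.1 * L * V₁.1ᴴ)
    rwa [hsNormSq_unitary_conj] at h

theorem integral_variationRange_sq_le_hsNormSq
    (hν : IsUnitaryDesign 2 ν₁ ∨ IsUnitaryDesign 2 ν₂) (H ρ : Matrix (A × B) (A × B) ℂ) :
    ((Fintype.card (A × B) : ℝ) ^ 2 - 1) * ∫ V, variationRange H ρ V ^ 2 ∂(ν₁.prod ν₂) ≤
      4 * (Fintype.card A : ℝ) ^ 4 * (hsNormSq (tracelessPart H) * hsNormSq (tracelessPart ρ)) := by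
  have hrhs : 0 ≤ hsNormSq (tracelessPart H) * hsNormSq (tracelessPart ρ) :=
    mul_nonneg (hsNormSq_nonneg _) (hsNormSq_nonneg _)
  rcases le_total ((Fintype.card (A × B) : ℝ) ^ 2 - 1) 0 with hd | hd
  · exact (mul_nonpos_of_nonpos_of_nonneg hd (integral_nonneg fun V => sq_nonneg _)).trans
      (by positivity)
  calc ((Fintype.card (A × B) : ℝ) ^ 2 - 1) * ∫ V, variationRange H ρ V ^ 2 ∂(ν₁.prod ν₂)
      ≤ ((Fintype.card (A × B) : ℝ) ^ 2 - 1) *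
          ∫ V, 4 * (Fintype.card A : ℝ) ^ 2 * localFormNormSq (V.2.1ᴴ * tracelessPart H * V.2.1)
            (V.1.1 * tracelessPart ρ * V.1.1ᴴ) ∂(ν₁.prod ν₂) := by
        refine mul_le_mul_of_nonneg_left (integral_mono (integrable_of_continuous (by fun_prop))
          ((integrable_localFormNormSq _ _).const_mul _) fun V => ?_) hd
        simp only [← variationRange_tracelessPart H ρ]
        exact variationRange_sq_le_localFormNormSq _ _ V
    _ = 4 * (Fintype.card A : ℝ) ^ 2 * (((Fintype.card (A × B) : ℝ) ^ 2 - 1) *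
          ∫ V, localFormNormSq (V.2.1ᴴ * tracelessPart H * V.2.1)
            (V.1.1 * tracelessPart ρ * V.1.1ᴴ) ∂(ν₁.prod ν₂)) := by
        rw [integral_const_mul, mul_left_comm]
    _ ≤ 4 * (Fintype.card A : ℝ) ^ 2 * ((Fintype.card A : ℝ) ^ 2 *
          (hsNormSq (tracelessPart H) * hsNormSq (tracelessPart ρ))) := by
        exact mul_le_mul_of_nonneg_left
          (integral_localFormNormSq_le hν (trace_tracelessPart H) (trace_tracelessPart ρ))
          (by positivity)
    _ = _ := by ring

variable {H ρ : Matrix (A × B) (A × B) ℂ}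

theorem integral_variationRange_sq_le_spectralWidth_sq (hH : H.IsHermitian)
    (hρ : IsDensityMatrix ρ) :
    ∫ V, variationRange H ρ V ^ 2 ∂(ν₁.prod ν₂) ≤ spectralWidth H ^ 2 := by
  calc ∫ V, variationRange H ρ V ^ 2 ∂(ν₁.prod ν₂)
      ≤ ∫ _, spectralWidth H ^ 2 ∂(ν₁.prod ν₂) :=
        integral_mono (integrable_of_continuous (by fun_prop)) (integrable_const _) fun V =>
          pow_le_pow_left₀ (variationRange_nonneg H ρ V) (variationRange_le_spectralWidth hH hρ V) 2
    _ = spectralWidth H ^ 2 := by simp only [integral_const, probReal_univ, one_smul]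

-- Adding `𝔼 Δ² ≤ w(H)²` to the bound on `(d² - 1) 𝔼 Δ²` gives a bound on `d² 𝔼 Δ²` that does not
-- degenerate at `d = 1`.
theorem card_mul_integral_variationRange_sq_le
    (hν : IsUnitaryDesign 2 ν₁ ∨ IsUnitaryDesign 2 ν₂) (hH : H.IsHermitian)
    (hρ : IsDensityMatrix ρ) [Nonempty (A × B)] :
    Fintype.card (A × B) * ∫ V, variationRange H ρ V ^ 2 ∂(ν₁.prod ν₂) ≤
      2 * (Fintype.card A : ℝ) ^ 4 * spectralWidth H ^ 2 := by
  have hA : (1 : ℝ) ≤ Fintype.card A := by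
    exact_mod_cast Fintype.card_pos_iff.2 (Nonempty.map Prod.fst ‹Nonempty (A × B)›)
  have hd : (1 : ℝ) ≤ Fintype.card (A × B) := by exact_mod_cast Fintype.card_pos
  obtain ⟨c, hc⟩ := exists_hsNormSq_sub_smul_one_le hH
  have hnormH := (hsNormSq_tracelessPart_le H c).trans hc
  have hnormρ : hsNormSq (tracelessPart ρ) ≤ 1 :=
    (hsNormSq_tracelessPart_le ρ 0).trans (by simpa using hρ.hsNormSq_le_one)
  have hmoment : ((Fintype.card (A × B) : ℝ) ^ 2 - 1) *
      ∫ V, variationRange H ρ V ^ 2 ∂(ν₁.prod ν₂) ≤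
        (Fintype.card A : ℝ) ^ 4 * spectralWidth H ^ 2 * Fintype.card (A × B) := by
    calc _ ≤ _ := integral_variationRange_sq_le_hsNormSq hν H ρ
      _ ≤ 4 * (Fintype.card A : ℝ) ^ 4 *
            (Fintype.card (A × B) * (spectralWidth H ^ 2 / 4) * 1) := by
          gcongr
          exact hsNormSq_nonneg _
      _ = _ := by ring
  have hwidth : spectralWidth H ^ 2 ≤
      (Fintype.card A : ℝ) ^ 4 * spectralWidth H ^ 2 * Fintype.card (A × B) := by
    rw [mul_right_comm]
    exact le_mul_of_one_le_left (sq_nonneg _) (one_le_mul_of_one_le_of_one_le (one_le_pow₀ hA) hd)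
  refine le_of_mul_le_mul_left ?_ (zero_lt_one.trans_le hd)
  linarith [integral_variationRange_sq_le_spectralWidth_sq (ν₁ := ν₁) (ν₂ := ν₂) hH hρ]

theorem integral_variationRange_le (hν : IsUnitaryDesign 2 ν₁ ∨ IsUnitaryDesign 2 ν₂)
    (hH : H.IsHermitian) (hρ : IsDensityMatrix ρ) :
    ∫ V, variationRange H ρ V ∂(ν₁.prod ν₂) ≤
      4 * spectralWidth H * (Fintype.card A : ℝ) ^ 2 *
        √((Fintype.card A : ℝ) / Fintype.card B) := by
  have : Nonempty (A × B) := hρ.nonempty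
  have hA : (1 : ℝ) ≤ Fintype.card A := by
    exact_mod_cast Fintype.card_pos_iff.2 (Nonempty.map Prod.fst ‹Nonempty (A × B)›)
  have hB : (0 : ℝ) < Fintype.card B := by
    exact_mod_cast Fintype.card_pos_iff.2 (Nonempty.map Prod.snd ‹Nonempty (A × B)›)
  have hL2 : MemLp (variationRange H ρ) 2 (ν₁.prod ν₂) :=
    (memLp_two_iff_integrable_sq (continuous_variationRange H ρ).aestronglyMeasurable).2
      (integrable_of_continuous (by fun_prop))
  have hw := spectralWidth_nonneg H
  have hsq := card_mul_integral_variationRange_sq_le hν hH hρ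
  rw [mul_comm, ← le_div_iff₀ (by exact_mod_cast Fintype.card_pos), Fintype.card_prod,
    Nat.cast_mul] at hsq
  refine le_of_sq_le_sq ?_ (by positivity)
  calc (∫ V, variationRange H ρ V ∂(ν₁.prod ν₂)) ^ 2
      ≤ ∫ V, variationRange H ρ V ^ 2 ∂(ν₁.prod ν₂) := sq_integral_le_integral_sq hL2
    _ ≤ 2 * (Fintype.card A : ℝ) ^ 4 * spectralWidth H ^ 2 /
          (Fintype.card A * Fintype.card B) := hsq
    _ ≤ 16 * (Fintype.card A : ℝ) ^ 4 * spectralWidth H ^ 2 *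
          (Fintype.card A / Fintype.card B) := by
        rw [← mul_div_assoc]
        gcongr ?_ / ?_
        · exact (by gcongr; norm_num : _ ≤ _).trans (le_mul_of_one_le_right (by positivity) hA)
        · exact le_mul_of_one_le_left (by positivity) hA
    _ = _ := by
        rw [mul_pow, Real.sq_sqrt (by positivity)]
        ring

theorem variance_variationRange_le (hν : IsUnitaryDesign 2 ν₁ ∨ IsUnitaryDesign 2 ν₂)
    (hH : H.IsHermitian) (hρ : IsDensityMatrix ρ) :
    variance (variationRange H ρ) (ν₁.prod ν₂) ≤
      4 * spectralWidth H ^ 2 * (Fintype.card A : ℝ) ^ 2 *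
        √((Fintype.card A : ℝ) / Fintype.card B) := by
  set m := ∫ V, variationRange H ρ V ∂(ν₁.prod ν₂)
  have hm : 0 ≤ m := integral_nonneg (variationRange_nonneg H ρ)
  calc variance (variationRange H ρ) (ν₁.prod ν₂) ≤ (spectralWidth H - m) * (m - 0) :=
        variance_le_sub_mul_sub (.of_forall fun V =>
          ⟨variationRange_nonneg H ρ V, variationRange_le_spectralWidth hH hρ V⟩)
          (continuous_variationRange H ρ).aemeasurable
    _ ≤ spectralWidth H * m := by nlinarith
    _ ≤ spectralWidth H * _ :=
        mul_le_mul_of_nonneg_left (integral_variationRange_le hν hH hρ) (spectralWidth_nonneg H)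
    _ = _ := by ring

theorem measureReal_le_variationRange_le (hν : IsUnitaryDesign 2 ν₁ ∨ IsUnitaryDesign 2 ν₂)
    (hH : H.IsHermitian) (hρ : IsDensityMatrix ρ) {ε : ℝ} (hε : 0 < ε) :
    (ν₁.prod ν₂).real {V | ε ≤ variationRange H ρ V} ≤
      4 * spectralWidth H * (Fintype.card A : ℝ) ^ 2 / ε *
        √((Fintype.card A : ℝ) / Fintype.card B) := by
  rw [div_mul_eq_mul_div, le_div_iff₀' hε]
  exact (mul_meas_ge_le_integral_of_nonneg (.of_forall (variationRange_nonneg H ρ))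
    (integrable_of_continuous (continuous_variationRange H ρ)) ε).trans
      (integral_variationRange_le hν hH hρ)

end Moments

theorem four_mul_sq_two_pow_mul_sqrt {n m : ℕ} (hmn : m ≤ n) :
    4 * ((2 : ℝ) ^ m) ^ 2 * √((2 : ℝ) ^ m / 2 ^ (n - m)) =
      ((2 : ℝ) ^ ((n : ℝ) / 2 - 3 * m - 2))⁻¹ := by
  have hfour : (4 : ℝ) = 2 ^ (2 : ℝ) := by norm_num
  rw [← Real.rpow_neg zero_le_two, Real.sqrt_eq_rpow, ← Real.rpow_natCast 2 m,
    ← Real.rpow_natCast 2 (n - m), ← Real.rpow_sub two_pos, ← Real.rpow_mul zero_le_two,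
    ← Real.rpow_natCast, ← Real.rpow_mul zero_le_two, hfour, ← Real.rpow_add two_pos,
    ← Real.rpow_add two_pos]
  congr 1
  push_cast [Nat.cast_sub hmn]
  ring

end VQA

theorem theorem1 {A B : Type*} [Fintype A] [DecidableEq A] [Fintype B] [DecidableEq B]
    (ν₁ ν₂ : Measure (Matrix.unitaryGroup (A × B) ℂ))
    [IsProbabilityMeasure ν₁] [IsProbabilityMeasure ν₂]
    (hν : VQA.IsUnitaryDesign 2 ν₁ ∨ VQA.IsUnitaryDesign 2 ν₂)
    (H ρ : Matrix (A × B) (A × B) ℂ) (hH : H.IsHermitian) (hρ : VQA.IsDensityMatrix ρ) :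
    Integrable (VQA.variationRange H ρ) (ν₁.prod ν₂) ∧
    -- arbitrary dimensions `d_A = card A`, `d_B = card B`
    (∫ V, VQA.variationRange H ρ V ∂(ν₁.prod ν₂) ≤
        4 * VQA.spectralWidth H * (Fintype.card A : ℝ) ^ 2 *
          √((Fintype.card A : ℝ) / Fintype.card B) ∧
      variance (VQA.variationRange H ρ) (ν₁.prod ν₂) ≤
        4 * VQA.spectralWidth H ^ 2 * (Fintype.card A : ℝ) ^ 2 *
          √((Fintype.card A : ℝ) / Fintype.card B) ∧
      ∀ ε : ℝ, 0 < ε →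
        (ν₁.prod ν₂).real {V | ε ≤ VQA.variationRange H ρ V} ≤
          4 * VQA.spectralWidth H * (Fintype.card A : ℝ) ^ 2 / ε *
            √((Fintype.card A : ℝ) / Fintype.card B)) ∧
    -- `n` qubits, of which `m` belong to `A` and `n - m` to `B`
    (∀ n m : ℕ, m ≤ n → Fintype.card A = 2 ^ m → Fintype.card B = 2 ^ (n - m) →
      ∫ V, VQA.variationRange H ρ V ∂(ν₁.prod ν₂) ≤
        VQA.spectralWidth H / (2 : ℝ) ^ ((n : ℝ) / 2 - 3 * m - 2) ∧
      variance (VQA.variationRange H ρ) (ν₁.prod ν₂) ≤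
        VQA.spectralWidth H ^ 2 / (2 : ℝ) ^ ((n : ℝ) / 2 - 3 * m - 2) ∧
      ∀ ε : ℝ, 0 < ε →
        (ν₁.prod ν₂).real {V | ε ≤ VQA.variationRange H ρ V} ≤
          1 / ε * (VQA.spectralWidth H / (2 : ℝ) ^ ((n : ℝ) / 2 - 3 * m - 2))) := by
  have hmean := VQA.integral_variationRange_le hν hH hρ
  have hvar := VQA.variance_variationRange_le hν hH hρ
  have htail := fun (ε : ℝ) (hε : 0 < ε) => VQA.measureReal_le_variationRange_le hν hH hρ hε
  refine ⟨VQA.integrable_of_continuous (VQA.continuous_variationRange H ρ),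
    ⟨hmean, hvar, htail⟩, fun n m hmn hA hB => ?_⟩
  have hqubits : 4 * (Fintype.card A : ℝ) ^ 2 * √((Fintype.card A : ℝ) / Fintype.card B) =
      ((2 : ℝ) ^ ((n : ℝ) / 2 - 3 * m - 2))⁻¹ := by
    simpa only [hA, hB, Nat.cast_pow, Nat.cast_ofNat] using VQA.four_mul_sq_two_pow_mul_sqrt hmn
  simp only [div_eq_mul_inv _ ((2 : ℝ) ^ ((n : ℝ) / 2 - 3 * m - 2)), ← hqubits]
  exact ⟨hmean.trans_eq (by ring), hvar.trans_eq (by ring),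
    fun ε hε => (htail ε hε).trans_eq (by ring)⟩
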